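/- Fix an integer $d\ge 2$. For integers $1\le k\le p$ put $n=p^d$, $s=k^d$, let $$\mathcal C_{p,k}=\{x\in\{0,k^{-1/2}\}^p:\ \|x\|=1\},\qquad \mathcal C_{n,s}=\{U\in\{0,s^{-1/2}\}^{n}:\ \|U\|=1\},$$ where $\mathbb R^{n}$ is the space of real $p\times\dots\times p$ tensors of order $d$ with the Frobenius norm (so $\mathcal C_{n,s}$ consists of all tensors with exactly $s$ entries equal to $s^{-1/2}$ and all other entries $0$, of rank one or not). Let $x$ be uniformly distributed on $\mathcal C_{p,k}$, let $X=x^{\otimes d}$, let $Z\in\mathbb R^n$ be independent of $X$ with i.i.d. $\mathcal N(0,1)$ entries, and for $\lambda\ge 0$ let $Y=\sqrt{\lambda}\,X+Z$. Define the constrained minimum mean square error $$\mathrm{CMMSE}_n(\lambda)=\min_{\hat X}\ \mathbb E\,\|X-\hat X(Y)\|^2,$$ the minimum being over all measurable $\hat X:\mathbb R^n\to\mathcal C_{n,s}$, and let $\lambda_n=2\log\binom{p}{k}$. Let $k=k(p)\ge 1$ satisfy $k=o\big((\log p)^{1/(2d-1)}\big)$ as $p\to\infty$. Then, as $p\to\infty$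 (hence $n=p^d\to\infty$) with $d$ fixed, $$\liminf_{n\to\infty}\mathrm{CMMSE}_n(\beta\lambda_n)\ \ge\ 1\quad\text{for every constant } 0\le\beta<1,$$ $$\lim_{n\to\infty}\mathrm{CMMSE}_n(\beta\lambda_n)\ =\ 0\quad\text{for every constant } \beta>1.$$ -/

import Mathlib

open MeasureTheory ProbabilityTheory Filter Topology
open scoped ENNReal

/-- `C_{ι,m}`: the vectors indexed by `ι` with all entries in `{0, 1/√m}` and Euclidean norm `1`
(so, for `m ≥ 1`, the vectors with exactly `m` entries equal to `1/√m` and all others `0`). -/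
def binarySphere (ι : Type*) [Fintype ι] (m : ℕ) : Set (EuclideanSpace ℝ ι) :=
  {x | ∀ i, x i = 0 ∨ x i = 1 / Real.sqrt m} ∩ Metric.sphere 0 1

/-- Real tensors of order `d` and side `p`, that is `ℝⁿ` with `n = p ^ d`, with the Frobenius norm. -/
abbrev Tensor (d p : ℕ) : Type := EuclideanSpace ℝ (Fin d → Fin p)

/-- The rank-one tensor `x^{⊗d}`, with entries `x_{i₁} ⋯ x_{i_d}`. -/
noncomputable def tensorPower (d : ℕ) {p : ℕ} (x : EuclideanSpace ℝ (Fin p)) : Tensor d p :=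
  WithLp.toLp 2 fun I => ∏ j, x (I j)

/-- The law of the signal `X = x^{⊗d}`, with `x` uniform on `C_{p,k}`. -/
noncomputable def signalPrior (d p k : ℕ) : Measure (Tensor d p) :=
  (uniformOn (binarySphere (Fin p) k)).map (tensorPower d)

/-- The mean square error `E ‖X - X̂(Y)‖²` of an estimator `X̂`, for the observation
`Y = √l • X + Z`, with `X` distributed as the signal and `Z` an independent tensor with
independent standard Gaussian entries. -/
noncomputable def meanSquareError (d p k : ℕ) (l : ℝ) (est : Tensor d p → Tensor d p) : ℝ≥0∞ :=
  ∫⁻ ω : Tensor d p × Tensor d p, ‖ω.1 - est (Real.sqrt l • ω.1 + ω.2)‖ₑ ^ 2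
    ∂((signalPrior d p k).prod (stdGaussian (Tensor d p)))

/-- The smallest mean square error of an estimator (a measurable function of the observation)
whose values are constrained to `A`. -/
noncomputable def constrainedMinLoss (d p k : ℕ) (A : Set (Tensor d p)) (l : ℝ) : ℝ≥0∞ :=
  ⨅ (est : Tensor d p → Tensor d p) (_ : Measurable est) (_ : ∀ Y, est Y ∈ A),
    meanSquareError d p k l est

/-- The constrained MMSE at signal-to-noise ratio `l`: the constraint set is `C_{n,s}` with
`s = k ^ d`, all binary unit tensors with `s` non-zero entries, of rank one or not. -/
noncomputable def cmmse (d p k : ℕ) (l : ℝ) : ℝ≥0∞ :=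
  constrainedMinLoss d p k (binarySphere (Fin d → Fin p) (k ^ d)) l

/-- The critical signal-to-noise ratio `2 log M`, with `M = binom(p, k)` the number of signals. -/
noncomputable def criticalSnr (p k : ℕ) : ℝ :=
  2 * Real.log (p.choose k)

/-! The M = binom(p, k) possible signals form a code of unit vectors, and one estimate drives both
halves: at signal-to-noise ratio B · 2 log M with B > 1, maximum likelihood decoding fails with
vanishing probability (`codeword_decoding_error_le`, `tendsto_decodingErrorBound`). Codewords whose
supports share a fraction t have inner product t^d. At most (kp)^j competitors differ from the true
support in j places, and each wins with probability at most about exp(-B (log M) j / k), roughly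
p^(-Bj) because k = p^o(1) and log M ~ k log p. For β > 1 the decoder is then itself an admissible
estimator with small error.

For β < 1, feed an estimator the observation Y₁ at ratio β · 2 log M and adjoin an independent
fictitious observation Y₂ at ratio (B - β) · 2 log M, with B slightly above 1. Together they have
ratio B, so the signal can be decoded. Compare their law with a reference law that ignores the
signal: Y₁ is pure noise and Y₂ is noise centred at the rescaled estimate computed from Y₁. The
relative entropy, averaged over signals, is (β + (B - β) · MSE) log M. Fano's argument
(`decoding_le_mean_square_error`) says that decoding M signals requires (1 - o(1)) log M of it.
Hence MSE ≥ (1 - β - o(1)) / (B - β), which approaches 1 as B decreases to 1. -/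

/-! ### Gaussian shifts and sub-Gaussian linear functionals. -/

section Gaussian

variable {κ : Type*} [Fintype κ]

/-- The exponential tilt θ and the Fourier variable t are treated together, so that this gives the
characteristic function of the tilted measure up to a constant. -/
theorem integral_cexp_inner_stdGaussian (θ t : EuclideanSpace ℝ κ) :
    ∫ z, Complex.exp (-(inner ℝ θ z : ℝ) + (inner ℝ z t : ℝ) * Complex.I)
      ∂(stdGaussian (EuclideanSpace ℝ κ)) =
      ∏ i, Complex.exp ((-(θ i : ℂ) + t i * Complex.I) ^ 2 / 2) := by
  rw [← map_pi_eq_stdGaussian, integral_map (by fun_prop) (by fun_prop)]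
  have h (x : κ → ℝ) :
      Complex.exp (-(inner ℝ θ (WithLp.toLp 2 x) : ℝ) +
        (inner ℝ (WithLp.toLp 2 x) t : ℝ) * Complex.I) =
      ∏ i, Complex.exp ((-(θ i : ℂ) + t i * Complex.I) * (x i : ℝ)) := by
    rw [← Complex.exp_sum]
    congr 1
    simp only [PiLp.inner_apply, RCLike.inner_apply, conj_trivial, Complex.ofReal_sum,
      Complex.ofReal_mul, Finset.sum_mul, add_mul, Finset.sum_add_distrib, ← Finset.sum_neg_distrib]
    congr 1 <;> refine Finset.sum_congr rfl fun i _ => by ring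
  simp_rw [h]
  rw [integral_fintype_prod_eq_prod
    (f := fun i (x : ℝ) => Complex.exp ((-(θ i : ℂ) + t i * Complex.I) * (x : ℝ)))]
  refine Finset.prod_congr rfl fun i _ => ?_
  have := complexMGF_id_gaussianReal (μ := 0) (v := 1) (z := (-(θ i : ℂ) + t i * Complex.I))
  simpa [complexMGF] using this

/-- The standard Gaussian measure reweighted by the density of a translate. -/
theorem map_withDensity_stdGaussian (θ : EuclideanSpace ℝ κ) :
    ((stdGaussian (EuclideanSpace ℝ κ)).withDensity
      fun z => ENNReal.ofReal (Real.exp (-(inner ℝ θ z : ℝ) - ‖θ‖ ^ 2 / 2))).map (fun z => z + θ) =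
      stdGaussian (EuclideanSpace ℝ κ) := by
  have hint : Integrable (fun z => Real.exp (-(inner ℝ θ z : ℝ) - ‖θ‖ ^ 2 / 2))
      (stdGaussian (EuclideanSpace ℝ κ)) := by
    have h0 := integral_cexp_inner_stdGaussian θ 0
    have h1 : Integrable (fun z => Complex.exp (-(inner ℝ θ z : ℝ) +
        (inner ℝ z (0 : EuclideanSpace ℝ κ) : ℝ) * Complex.I))
        (stdGaussian (EuclideanSpace ℝ κ)) := by
      -- A non-integrable function has Bochner integral 0, whereas the computed value is a product
      -- of exponentials.
      by_contra hc
      rw [integral_undef hc] at h0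
      exact (Finset.prod_ne_zero_iff.2 fun i _ => Complex.exp_ne_zero _) h0.symm
    have h2 := (h1.norm).mul_const (Real.exp (-(‖θ‖ ^ 2 / 2)))
    refine h2.congr (ae_of_all _ fun z => ?_)
    simp only [inner_zero_right, Complex.norm_exp, sub_eq_add_neg, Real.exp_add]
    simp
  have hfin : IsFiniteMeasure ((stdGaussian (EuclideanSpace ℝ κ)).withDensity
      fun z => ENNReal.ofReal (Real.exp (-(inner ℝ θ z : ℝ) - ‖θ‖ ^ 2 / 2))) :=
    isFiniteMeasure_withDensity_ofReal hint.2
  apply Measure.ext_of_charFun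
  ext t
  rw [charFun_apply, integral_map (by fun_prop) (by fun_prop), charFun_stdGaussian]
  rw [integral_withDensity_eq_integral_toReal_smul (by fun_prop) (by simp)]
  have h (z : EuclideanSpace ℝ κ) :
      (ENNReal.ofReal (Real.exp (-(inner ℝ θ z : ℝ) - ‖θ‖ ^ 2 / 2))).toReal •
        Complex.exp ((inner ℝ (z + θ) t : ℝ) * Complex.I) =
      Complex.exp (-(inner ℝ θ z : ℝ) + (inner ℝ z t : ℝ) * Complex.I) *
        Complex.exp ((inner ℝ θ t : ℝ) * Complex.I - (‖θ‖ : ℂ) ^ 2 / 2) := by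
    rw [ENNReal.toReal_ofReal (Real.exp_pos _).le, Complex.real_smul, Complex.ofReal_exp,
      ← Complex.exp_add, ← Complex.exp_add, inner_add_left]
    congr 1
    push_cast
    ring
  simp_rw [h]
  rw [integral_mul_const, integral_cexp_inner_stdGaussian, ← Complex.exp_sum, ← Complex.exp_add]
  congr 1
  have e1 : ((‖θ‖ : ℝ) : ℂ) ^ 2 = ∑ i, (θ i : ℂ) ^ 2 := by
    rw [← Complex.ofReal_pow, EuclideanSpace.real_norm_sq_eq]; push_cast; rfl
  have e2 : ((‖t‖ : ℝ) : ℂ) ^ 2 = ∑ i, (t i : ℂ) ^ 2 := by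
    rw [← Complex.ofReal_pow, EuclideanSpace.real_norm_sq_eq]; push_cast; rfl
  have e3 : ((inner ℝ θ t : ℝ) : ℂ) = ∑ i, (θ i : ℂ) * t i := by
    simp [PiLp.inner_apply, mul_comm]
  rw [e1, e2, e3]
  simp only [Finset.sum_mul, Finset.sum_div, ← Finset.sum_neg_distrib, ← Finset.sum_sub_distrib,
    ← Finset.sum_add_distrib]
  refine Finset.sum_congr rfl fun i _ => ?_
  linear_combination (t i : ℂ) ^ 2 / 2 * Complex.I_sq

/-- Cameron–Martin change of variables. -/
theorem lintegral_shift_stdGaussian (θ : EuclideanSpace ℝ κ) {g : EuclideanSpace ℝ κ → ℝ≥0∞}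
    (hg : Measurable g) :
    ∫⁻ z, ENNReal.ofReal (Real.exp (-(inner ℝ θ z : ℝ) - ‖θ‖ ^ 2 / 2)) * g (z + θ)
      ∂(stdGaussian (EuclideanSpace ℝ κ)) = ∫⁻ z, g z ∂(stdGaussian (EuclideanSpace ℝ κ)) := by
  conv_rhs => rw [← map_withDensity_stdGaussian θ]
  rw [lintegral_map hg (by fun_prop),
    lintegral_withDensity_eq_lintegral_mul _ (by fun_prop) (by fun_prop)]
  rfl

theorem map_inner_stdGaussian (v : EuclideanSpace ℝ κ) :
    (stdGaussian (EuclideanSpace ℝ κ)).map (fun z => inner ℝ v z) =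
      gaussianReal 0 (‖v‖₊ ^ 2) := by
  have h := IsGaussian.map_eq_gaussianReal (μ := stdGaussian (EuclideanSpace ℝ κ)) (innerSL ℝ v)
  rw [variance_dual_stdGaussian, integral_strongDual_stdGaussian, innerSL_apply_norm] at h
  have e : (‖v‖ ^ 2).toNNReal = ‖v‖₊ ^ 2 := by
    rw [Real.toNNReal_pow (norm_nonneg _), norm_toNNReal]
  rw [e] at h
  exact h

theorem hasSubgaussianMGF_inner_stdGaussian (v : EuclideanSpace ℝ κ) :
    HasSubgaussianMGF (fun z => inner ℝ v z) (‖v‖₊ ^ 2) (stdGaussian (EuclideanSpace ℝ κ)) := by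
  have h : HasSubgaussianMGF (id : ℝ → ℝ) (‖v‖₊ ^ 2) (gaussianReal 0 (‖v‖₊ ^ 2)) := by
    constructor
    · intro t
      exact integrable_exp_mul_gaussianReal t
    · intro t
      rw [mgf_id_gaussianReal]
      simp
  rw [← map_inner_stdGaussian] at h
  exact HasSubgaussianMGF.of_map (Y := fun z => inner ℝ v z) (X := id) (by fun_prop) h

/-- This is the noise left after merging two observations into one with normalized weights. -/
theorem hasSubgaussianMGF_inner_prod_stdGaussian {a b : ℝ} (hab : a ^ 2 + b ^ 2 = 1)
    (v : EuclideanSpace ℝ κ) :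
    HasSubgaussianMGF (fun z : EuclideanSpace ℝ κ × EuclideanSpace ℝ κ =>
        inner ℝ v (a • z.1 + b • z.2)) (‖v‖₊ ^ 2)
      ((stdGaussian (EuclideanSpace ℝ κ)).prod (stdGaussian (EuclideanSpace ℝ κ))) := by
  have h1 : HasSubgaussianMGF (fun z : EuclideanSpace ℝ κ × EuclideanSpace ℝ κ =>
      inner ℝ (a • v) z.1) (‖a • v‖₊ ^ 2)
      ((stdGaussian (EuclideanSpace ℝ κ)).prod (stdGaussian (EuclideanSpace ℝ κ))) := by
    have := hasSubgaussianMGF_inner_stdGaussian (a • v)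
    refine HasSubgaussianMGF.of_map (Y := Prod.fst) (by fun_prop) (X := fun z => inner ℝ (a • v) z) ?_
    simpa using this
  have h2 : HasSubgaussianMGF (fun z : EuclideanSpace ℝ κ × EuclideanSpace ℝ κ =>
      inner ℝ (b • v) z.2) (‖b • v‖₊ ^ 2)
      ((stdGaussian (EuclideanSpace ℝ κ)).prod (stdGaussian (EuclideanSpace ℝ κ))) := by
    have := hasSubgaussianMGF_inner_stdGaussian (b • v)
    refine HasSubgaussianMGF.of_map (Y := Prod.snd) (by fun_prop) (X := fun z => inner ℝ (b • v) z) ?_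
    simpa using this
  have h3 := h1.add_of_indepFun h2 (indepFun_prod (by fun_prop) (by fun_prop))
  have e : ‖a • v‖₊ ^ 2 + ‖b • v‖₊ ^ 2 = ‖v‖₊ ^ 2 := by
    rw [← NNReal.coe_inj]
    push_cast
    rw [norm_smul, norm_smul, mul_pow, mul_pow, Real.norm_eq_abs, Real.norm_eq_abs, sq_abs, sq_abs,
      ← add_mul, hab, one_mul]
  rw [e] at h3
  refine h3.congr (ae_of_all _ fun z => ?_)
  simp [inner_add_right, inner_smul_left, inner_smul_right]

end Gaussian

/-! ### Maximum likelihood decoding of a finite code. -/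

section Decoder

variable {E ι : Type*} [NormedAddCommGroup E] [InnerProductSpace ℝ E] [Fintype ι]

/-- Maximum likelihood decoding of a finite codebook, as a measurable function. -/
theorem exists_measurable_decoder [Nonempty ι] [MeasurableSpace E] [BorelSpace E]
    [SecondCountableTopology E] (X : ι → E) :
    ∃ D : E → ι, (∀ i, MeasurableSet (D ⁻¹' {i})) ∧
      ∀ i y, (∀ j, j ≠ i → (inner ℝ (X j) y : ℝ) < inner ℝ (X i) y) → D y = i := by
  classical
  let A : ι → Set E := fun i => {y | ∀ j, j ≠ i → (inner ℝ (X j) y : ℝ) < inner ℝ (X i) y}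
  have hA (i : ι) : MeasurableSet (A i) := by
    have : A i = ⋂ j, ⋂ (_ : j ≠ i), {y | (inner ℝ (X j) y : ℝ) < inner ℝ (X i) y} := by
      ext y; simp [A]
    rw [this]
    exact MeasurableSet.iInter fun j => MeasurableSet.iInter fun _ =>
      measurableSet_lt (by fun_prop) (by fun_prop)
  have huniq {i j : ι} {y : E} (hi : y ∈ A i) (hj : y ∈ A j) : i = j := by
    by_contra hne
    exact lt_asymm (hi j (Ne.symm hne)) (hj i hne)
  let i₀ : ι := Classical.arbitrary ι
  -- Ties go to the default `i₀`, so its cell is the complement of all the other strict cells; they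
  -- count as errors later.
  let D : E → ι := fun y => if h : ∃ i, y ∈ A i then h.choose else i₀
  have hD {i : ι} {y : E} (hi : y ∈ A i) : D y = i := by
    have h : ∃ i, y ∈ A i := ⟨i, hi⟩
    simp only [D, dif_pos h]
    exact huniq h.choose_spec hi
  refine ⟨D, fun i => ?_, fun i y h => hD h⟩
  by_cases hi : i = i₀
  · have : D ⁻¹' {i} = (⋃ j, ⋃ (_ : j ≠ i), A j)ᶜ := by
      ext y
      simp only [Set.mem_preimage, Set.mem_singleton_iff, Set.mem_compl_iff, Set.mem_iUnion,
        not_exists]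
      constructor
      · intro h j hj hy
        exact hj ((hD hy).symm.trans h)
      · intro h
        by_cases h' : ∃ j, y ∈ A j
        · obtain ⟨j, hj⟩ := h'
          by_cases hji : j = i
          · exact hji ▸ hD hj
          · exact absurd hj (h j hji)
        · simp only [D, dif_neg h']
          exact hi.symm
    rw [this]
    exact (MeasurableSet.iUnion fun j => MeasurableSet.iUnion fun _ => hA j).compl
  · have : D ⁻¹' {i} = A i := by
      ext y
      simp only [Set.mem_preimage, Set.mem_singleton_iff]
      refine ⟨fun h => ?_, hD⟩
      by_cases h' : ∃ j, y ∈ A j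
      · obtain ⟨j, hj⟩ := h'
        rwa [← h, hD hj]
      · simp only [D, dif_neg h'] at h
        exact absurd h.symm hi
    rw [this]
    exact hA i

/-- Error probability of maximum likelihood decoding with sub-Gaussian noise. -/
theorem decoding_error_le [DecidableEq ι] {Ω : Type*} [MeasurableSpace Ω] {μ : Measure Ω}
    [IsProbabilityMeasure μ] {W : Ω → E}
    (hW : ∀ v : E, HasSubgaussianMGF (fun ω => inner ℝ v (W ω)) (‖v‖₊ ^ 2) μ)
    {X : ι → E} (hX : ∀ i, ‖X i‖ = 1) (i : ι)
    (h0 : ∀ j, (0 : ℝ) ≤ inner ℝ (X i) (X j)) (h1 : ∀ j, j ≠ i → (inner ℝ (X i) (X j) : ℝ) < 1)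
    {ε s : ℝ} (hε0 : 0 ≤ ε) (hε1 : ε ≤ 1) (hs : 0 ≤ s) :
    μ.real {ω | ∃ j, j ≠ i ∧
        (inner ℝ (X i) (s • X i + W ω) : ℝ) ≤ inner ℝ (X j) (s • X i + W ω)} ≤
      Real.exp (-(ε * s) ^ 2 / 2) + ∑ j ∈ Finset.univ.erase i,
        Real.exp (-(((1 - ε) * s) ^ 2 / 2 *
          ((1 - inner ℝ (X i) (X j)) / (1 + inner ℝ (X i) (X j))))) := by
  -- The noise along `X i`, common to all competitors, is paid for once in `A`; `B j` involves only
  -- the component of `X j` orthogonal to `X i`, of squared norm 1 - ρ², where ρ is the inner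
  -- product. The exponent becomes (1 - ρ)/(1 + ρ) times s²/2 up to ε, where a direct pairwise bound
  -- gives only (1 - ρ)s²/4, missing the threshold by a factor 2 at ρ = 0.
  let A : Set Ω := {ω | ε * s ≤ (inner ℝ (-X i) (W ω) : ℝ)}
  let B : ι → Set Ω := fun j => {ω | (1 - (inner ℝ (X i) (X j) : ℝ)) * ((1 - ε) * s) ≤
    (inner ℝ (X j - (inner ℝ (X i) (X j) : ℝ) • X i) (W ω) : ℝ)}
  have hsub : {ω | ∃ j, j ≠ i ∧
      (inner ℝ (X i) (s • X i + W ω) : ℝ) ≤ inner ℝ (X j) (s • X i + W ω)} ⊆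
      A ∪ ⋃ j ∈ Finset.univ.erase i, B j := by
    rintro ω ⟨j, hj, hle⟩
    by_cases hA : ω ∈ A
    · exact Or.inl hA
    · right
      simp only [Set.mem_iUnion]
      refine ⟨j, by simp [hj], ?_⟩
      simp only [A, Set.mem_ofPred_eq, inner_neg_left, not_le] at hA
      simp only [B, Set.mem_ofPred_eq, inner_sub_left, inner_smul_left, conj_trivial]
      simp only [inner_add_right, inner_smul_right, real_inner_self_eq_norm_sq, hX] at hle
      rw [real_inner_comm (X i) (X j)] at hle
      nlinarith [mul_pos (sub_pos.2 (h1 j hj)) (sub_pos.2 hA)]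
  have hA : μ.real A ≤ Real.exp (-(ε * s) ^ 2 / 2) := by
    refine ((hW (-X i)).measure_ge_le (mul_nonneg hε0 hs)).trans_eq ?_
    simp [hX]
  have hB (j : ι) (hj : j ≠ i) : μ.real (B j) ≤ Real.exp (-(((1 - ε) * s) ^ 2 / 2 *
      ((1 - inner ℝ (X i) (X j)) / (1 + inner ℝ (X i) (X j))))) := by
    have hρ1 := h1 j hj
    have hρ0 := h0 j
    refine ((hW _).measure_ge_le (mul_nonneg (sub_nonneg.2 hρ1.le)
      (mul_nonneg (sub_nonneg.2 hε1) hs))).trans_eq ?_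
    congr 1
    have hn : ‖X j - (inner ℝ (X i) (X j) : ℝ) • X i‖ ^ 2 =
        (1 - (inner ℝ (X i) (X j) : ℝ)) * (1 + (inner ℝ (X i) (X j) : ℝ)) := by
      rw [norm_sub_sq_real, norm_smul, inner_smul_right, hX, hX, real_inner_comm, Real.norm_eq_abs,
        mul_one, sq_abs]
      ring
    push_cast
    rw [hn]
    have a1 : (1 - (inner ℝ (X i) (X j) : ℝ)) ≠ 0 := by linarith
    have a2 : (1 + (inner ℝ (X i) (X j) : ℝ)) ≠ 0 := by linarith
    field_simp
  refine (measureReal_mono hsub).trans ((measureReal_union_le _ _).trans (add_le_add hA ?_))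
  refine (measureReal_biUnion_finset_le _ _).trans (Finset.sum_le_sum fun j hj => hB j ?_)
  simpa using hj

end Decoder

/-! ### The code of rank-one tensors and its distance distribution. -/

section Codebook

/-- The tensor power of the normalized indicator vector of a set. -/
noncomputable def codeword (d k : ℕ) {p : ℕ} (S : Finset (Fin p)) : Tensor d p :=
  tensorPower d (WithLp.toLp 2 fun i => if i ∈ S then 1 / Real.sqrt k else 0)

theorem inner_codeword (d : ℕ) {k p : ℕ} (S T : Finset (Fin p)) :
    (inner ℝ (codeword d k S) (codeword d k T) : ℝ) = ((S ∩ T).card / k : ℝ) ^ d := by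
  classical
  simp only [codeword, tensorPower, PiLp.inner_apply, RCLike.inner_apply, conj_trivial,
    ← Finset.prod_mul_distrib]
  rw [← Fintype.piFinset_univ, ← Finset.prod_univ_sum (fun _ : Fin d => (Finset.univ : Finset (Fin p)))
    (fun _ i => (if i ∈ T then 1 / Real.sqrt k else 0) * (if i ∈ S then 1 / Real.sqrt k else 0))]
  simp only [Finset.prod_const, Finset.card_univ, Fintype.card_fin]
  congr 1
  have (i : Fin p) : ((if i ∈ T then 1 / Real.sqrt k else 0) *
      (if i ∈ S then 1 / Real.sqrt k else 0) : ℝ) = if i ∈ S ∩ T then (1 / k : ℝ) else 0 := by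
    by_cases hS : i ∈ S <;> by_cases hT : i ∈ T <;> simp [hS, hT, ← mul_inv]
  simp only [this]
  rw [Finset.sum_ite_mem, Finset.univ_inter, Finset.sum_const, nsmul_eq_mul]
  ring

theorem norm_codeword (d : ℕ) {k p : ℕ} (hk : 1 ≤ k) {S : Finset (Fin p)} (hS : S.card = k) :
    ‖codeword d k S‖ = 1 := by
  have h := inner_codeword d (k := k) S S
  have hk' : (k : ℝ) ≠ 0 := by positivity
  rw [real_inner_self_eq_norm_sq, Finset.inter_self, hS, div_self hk', one_pow] at h
  exact (pow_eq_one_iff_of_nonneg (norm_nonneg _) two_ne_zero).1 h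

theorem codeword_mem_binarySphere (d : ℕ) {k p : ℕ} (hk : 1 ≤ k) {S : Finset (Fin p)}
    (hS : S.card = k) : codeword d k S ∈ binarySphere (Fin d → Fin p) (k ^ d) := by
  refine ⟨fun I => ?_, by simp [norm_codeword d hk hS]⟩
  simp only [codeword, tensorPower]
  by_cases h : ∀ j, I j ∈ S
  · right
    simp only [h, if_true, Finset.prod_const, Finset.card_univ, Fintype.card_fin]
    push_cast
    rw [div_pow, one_pow, Real.sqrt_eq_rpow, Real.sqrt_eq_rpow, ← Real.rpow_natCast,
      ← Real.rpow_natCast, ← Real.rpow_mul (by positivity), ← Real.rpow_mul (by positivity), mul_comm]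
  · left
    push Not at h
    obtain ⟨j, hj⟩ := h
    exact Finset.prod_eq_zero (Finset.mem_univ j) (by simp [hj])

theorem card_inter_lt {p k : ℕ} {S T : Finset (Fin p)} (hS : S.card = k) (hT : T.card = k)
    (h : T ≠ S) : (S ∩ T).card < k := by
  refine lt_of_le_of_ne (hS ▸ Finset.card_le_card Finset.inter_subset_left) fun hc => h ?_
  have h1 : S ∩ T = S := Finset.eq_of_subset_of_card_le Finset.inter_subset_left (by omega)
  have h2 : S ∩ T = T := Finset.eq_of_subset_of_card_le Finset.inter_subset_right (by omega)
  exact h2.symm.trans h1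

theorem inner_codeword_lt_one {d p k : ℕ} (hd : d ≠ 0) {S T : Finset (Fin p)} (hS : S.card = k)
    (hT : T.card = k) (h : T ≠ S) :
    (inner ℝ (codeword d k S) (codeword d k T) : ℝ) < 1 := by
  have hlt := card_inter_lt hS hT h
  have hk : (0 : ℝ) < k := by exact_mod_cast (Nat.zero_le _).trans_lt hlt
  rw [inner_codeword]
  refine pow_lt_one₀ (by positivity) ?_ hd
  rw [div_lt_one hk]
  exact_mod_cast hlt

theorem inner_codeword_nonneg (d k : ℕ) {p : ℕ} (S T : Finset (Fin p)) :
    (0 : ℝ) ≤ inner ℝ (codeword d k S) (codeword d k T) := by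
  rw [inner_codeword]; positivity

/-- This makes the error exponent linear in the number of differing support elements, so the union
bound becomes a geometric series. It reduces to t^d ≤ t² and would fail for d = 1 at 0 < t < 1. -/
theorem one_sub_le_one_sub_pow_div {d : ℕ} (hd : 2 ≤ d) {t : ℝ} (h0 : 0 ≤ t) (h1 : t ≤ 1) :
    1 - t ≤ (1 - t ^ d) / (1 + t ^ d) := by
  have hp : t ^ d ≤ t ^ 2 := pow_le_pow_of_le_one h0 h1 hd
  have hn : 0 ≤ t ^ d := by positivity
  rw [le_div_iff₀ (by linarith)]
  nlinarith [mul_nonneg (sub_nonneg.2 h1) h0, mul_nonneg (mul_nonneg (sub_nonneg.2 h1) h0) (sub_nonneg.2 h1)]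

/-- Generating function bound for the number of `k`-subsets at a given distance. -/
theorem sum_pow_sub_card_inter_le {p k : ℕ} {S : Finset (Fin p)} (hS : S.card = k) {y : ℝ}
    (hy : 0 ≤ y) (h : k * p * y ≤ 1 / 2) :
    ∑ T ∈ (Finset.univ.powersetCard k).erase S, y ^ (k - (S ∩ T).card) ≤ 2 * (k * p * y) := by
  classical
  have hmaps : ∀ T ∈ (Finset.univ.powersetCard k).erase S,
      k - (S ∩ T).card ∈ Finset.Icc 1 k := by
    intro T hT
    rw [Finset.mem_erase, Finset.mem_powersetCard] at hT
    have := card_inter_lt hS hT.2.2 hT.1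
    rw [Finset.mem_Icc]; omega
  rw [← Finset.sum_fiberwise_of_maps_to hmaps]
  have hcount (j : ℕ) : (((Finset.univ.powersetCard k).erase S).filter
      fun T => k - (S ∩ T).card = j).card ≤ k ^ j * p ^ j := by
    have hinj : (((Finset.univ.powersetCard k).erase S).filter
        fun T => k - (S ∩ T).card = j).card ≤
        (S.powersetCard j ×ˢ (Finset.univ : Finset (Fin p)).powersetCard j).card := by
      -- `T` is recovered from the j elements removed from `S` and the j elements added to it.
      refine Finset.card_le_card_of_injOn (fun T => (S \ T, T \ S)) ?_ ?_
      · intro T hT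
        simp only [Finset.coe_filter, Set.mem_ofPred_eq, Finset.mem_erase,
          Finset.mem_powersetCard] at hT
        obtain ⟨⟨-, -, hTk⟩, hj⟩ := hT
        have e1 := Finset.card_sdiff_add_card_inter S T
        have e2 := Finset.card_sdiff_add_card_inter T S
        rw [Finset.inter_comm] at e2
        simp only [Finset.coe_product, Set.mem_prod, Finset.mem_coe, Finset.mem_powersetCard]
        refine ⟨⟨Finset.sdiff_subset, by omega⟩, Finset.subset_univ _, by omega⟩
      · intro T _ T' _ hTT
        simp only [Prod.mk.injEq] at hTT
        have r (U : Finset (Fin p)) : U = (S \ (S \ U)) ∪ (U \ S) := by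
          ext a; simp; tauto
        rw [r T, r T', hTT.1, hTT.2]
    refine hinj.trans ?_
    rw [Finset.card_product, Finset.card_powersetCard, Finset.card_powersetCard, hS,
      Finset.card_univ, Fintype.card_fin]
    exact Nat.mul_le_mul (Nat.choose_le_pow _ _) (Nat.choose_le_pow _ _)
  have hterm : ∀ j ∈ Finset.Icc 1 k, ∑ T ∈ ((Finset.univ.powersetCard k).erase S).filter
      (fun T => k - (S ∩ T).card = j), y ^ (k - (S ∩ T).card) ≤ (k * p * y) ^ j := by
    intro j _
    rw [Finset.sum_congr rfl (g := fun _ => y ^ j)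
      (fun T hT => by rw [(Finset.mem_filter.1 hT).2]), Finset.sum_const, nsmul_eq_mul]
    calc _ ≤ ((k ^ j * p ^ j : ℕ) : ℝ) * y ^ j := by gcongr; exact hcount j
      _ = _ := by push_cast; ring
  refine (Finset.sum_le_sum hterm).trans ?_
  set q : ℝ := k * p * y
  have hq : 0 ≤ q := by positivity
  -- The subtracted tail makes the induction close, using q ≤ 1/2.
  have hgeom (n : ℕ) : ∑ j ∈ Finset.Icc 1 n, q ^ j ≤ 2 * q - 2 * (q ^ n * q) := by
    induction n with
    | zero => simp
    | succ n ih =>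
      rw [Finset.sum_Icc_succ_top (by omega)]
      have : 0 ≤ q ^ n * q * (1 - 2 * q) := by
        have : 0 ≤ 1 - 2 * q := by linarith
        positivity
      have e : q ^ (n + 1) = q ^ n * q := pow_succ _ _
      nlinarith [this, e]
  have : 0 ≤ q ^ k * q := by positivity
  linarith [hgeom k]

end Codebook

/-! ### Change of measure and Fano's inequality for two observations. -/

section TwoObservations

variable {κ : Type*} [Fintype κ]

/-- The log-likelihood ratio, at signal `x` and noise `w`, between the observations
`(a • x + w.1, b • x + w.2)` and `(w.1, b • est w.1 + w.2)`. -/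
noncomputable def logLikelihoodRatio (a b : ℝ) (est : EuclideanSpace ℝ κ → EuclideanSpace ℝ κ)
    (x : EuclideanSpace ℝ κ) (w : EuclideanSpace ℝ κ × EuclideanSpace ℝ κ) : ℝ :=
  a * inner ℝ x w.1 + a ^ 2 / 2 + b * inner ℝ (x - est (a • x + w.1)) w.2 +
    b ^ 2 / 2 * ‖x - est (a • x + w.1)‖ ^ 2

variable {a b : ℝ} {est : EuclideanSpace ℝ κ → EuclideanSpace ℝ κ} {x : EuclideanSpace ℝ κ}

theorem measurable_logLikelihoodRatio (hest : Measurable est) :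
    Measurable (logLikelihoodRatio a b est x) := by
  unfold logLikelihoodRatio
  fun_prop

/-- For a fixed first observation the estimate is a constant, so the second noise can be shifted by
b(x - est); the first noise is then shifted by a x. The right side no longer depends on `x`. -/
theorem lintegral_exp_neg_logLikelihoodRatio_mul (hest : Measurable est) (hx : ‖x‖ = 1)
    {G : EuclideanSpace ℝ κ × EuclideanSpace ℝ κ → ℝ≥0∞} (hG : Measurable G) :
    ∫⁻ w, ENNReal.ofReal (Real.exp (-logLikelihoodRatio a b est x w)) *
        G (a • x + w.1, b • x + w.2)
      ∂((stdGaussian (EuclideanSpace ℝ κ)).prod (stdGaussian (EuclideanSpace ℝ κ))) =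
    ∫⁻ w, G (w.1, b • est w.1 + w.2)
      ∂((stdGaussian (EuclideanSpace ℝ κ)).prod (stdGaussian (EuclideanSpace ℝ κ))) := by
  have hL := measurable_logLikelihoodRatio (a := a) (b := b) (x := x) hest
  rw [lintegral_prod _ (by fun_prop), lintegral_prod _ (by fun_prop)]
  have inner_eq (z : EuclideanSpace ℝ κ) :
      ∫⁻ z', ENNReal.ofReal (Real.exp (-logLikelihoodRatio a b est x (z, z'))) *
          G (a • x + z, b • x + z') ∂(stdGaussian (EuclideanSpace ℝ κ)) =
      ENNReal.ofReal (Real.exp (-(inner ℝ (a • x) z : ℝ) - ‖a • x‖ ^ 2 / 2)) *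
        ∫⁻ z', G (z + a • x, b • est (z + a • x) + z') ∂(stdGaussian (EuclideanSpace ℝ κ)) := by
    rw [← lintegral_shift_stdGaussian (b • (x - est (z + a • x)))
      (g := fun z' => G (z + a • x, b • est (z + a • x) + z')) (by fun_prop),
      ← lintegral_const_mul _ (by fun_prop)]
    refine lintegral_congr fun z' => ?_
    rw [← mul_assoc, ← ENNReal.ofReal_mul (Real.exp_pos _).le, ← Real.exp_add]
    congr 3
    · simp only [logLikelihoodRatio, norm_smul, inner_smul_left, hx, conj_trivial, mul_pow,
        Real.norm_eq_abs, sq_abs, add_comm z]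
      ring
    · rw [add_comm]
    · rw [smul_sub]; abel
  simp_rw [inner_eq]
  exact lintegral_shift_stdGaussian (a • x)
    (g := fun z => ∫⁻ z', G (z, b • est z + z') ∂(stdGaussian (EuclideanSpace ℝ κ)))
    (Measurable.lintegral_prod_right' (f := fun w : EuclideanSpace ℝ κ × EuclideanSpace ℝ κ =>
      G (w.1, b • est w.1 + w.2)) (by fun_prop))

theorem integrable_exp_neg_logLikelihoodRatio (hest : Measurable est) (hx : ‖x‖ = 1) :
    Integrable (fun w => Real.exp (-logLikelihoodRatio a b est x w))
      ((stdGaussian (EuclideanSpace ℝ κ)).prod (stdGaussian (EuclideanSpace ℝ κ))) := by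
  have hL := measurable_logLikelihoodRatio (a := a) (b := b) (x := x) hest
  refine ⟨by fun_prop, ?_⟩
  rw [hasFiniteIntegral_iff_ofReal (ae_of_all _ fun w => (Real.exp_pos _).le)]
  have := lintegral_exp_neg_logLikelihoodRatio_mul (a := a) (b := b) hest hx (G := fun _ => 1)
    measurable_const
  simp only [mul_one, lintegral_const, measure_univ] at this
  rw [this]
  exact ENNReal.one_lt_top

theorem integrable_norm_sub_sq (hest : Measurable est) (hx : ‖x‖ = 1) (hn : ∀ y, ‖est y‖ = 1) :
    Integrable (fun z => ‖x - est (a • x + z)‖ ^ 2) (stdGaussian (EuclideanSpace ℝ κ)) := by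
  refine Integrable.of_bound (Measurable.aestronglyMeasurable (by fun_prop)) 4 (ae_of_all _ fun z => ?_)
  have := norm_sub_le x (est (a • x + z))
  rw [hx, hn] at this
  rw [Real.norm_eq_abs, abs_of_nonneg (by positivity)]
  nlinarith [norm_nonneg (x - est (a • x + z))]

theorem integral_inner_stdGaussian (v : EuclideanSpace ℝ κ) :
    ∫ z, (inner ℝ v z : ℝ) ∂(stdGaussian (EuclideanSpace ℝ κ)) = 0 :=
  integral_strongDual_stdGaussian (innerSL ℝ v)

theorem integrable_inner_sub_est (hest : Measurable est) (hx : ‖x‖ = 1) (hn : ∀ y, ‖est y‖ = 1) :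
    Integrable (fun w : EuclideanSpace ℝ κ × EuclideanSpace ℝ κ =>
        (inner ℝ (x - est (a • x + w.1)) w.2 : ℝ))
      ((stdGaussian (EuclideanSpace ℝ κ)).prod (stdGaussian (EuclideanSpace ℝ κ))) := by
  have h : Integrable (fun z => ‖z‖) (stdGaussian (EuclideanSpace ℝ κ)) :=
    (IsGaussian.integrable_id (μ := stdGaussian (EuclideanSpace ℝ κ))).norm
  have h2 : Integrable (fun w : EuclideanSpace ℝ κ × EuclideanSpace ℝ κ => 2 * ‖w.2‖)
      ((stdGaussian (EuclideanSpace ℝ κ)).prod (stdGaussian (EuclideanSpace ℝ κ))) :=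
    (h.comp_snd _).const_mul 2
  refine h2.mono' (by fun_prop) (ae_of_all _ fun w => ?_)
  refine (norm_inner_le_norm _ _).trans ?_
  gcongr
  have := norm_sub_le x (est (a • x + w.1))
  rw [hx, hn] at this
  linarith

theorem integrable_logLikelihoodRatio (hest : Measurable est) (hx : ‖x‖ = 1)
    (hn : ∀ y, ‖est y‖ = 1) :
    Integrable (logLikelihoodRatio a b est x)
      ((stdGaussian (EuclideanSpace ℝ κ)).prod (stdGaussian (EuclideanSpace ℝ κ))) := by
  have h1 : Integrable (fun z => (inner ℝ x z : ℝ)) (stdGaussian (EuclideanSpace ℝ κ)) :=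
    (hasSubgaussianMGF_inner_stdGaussian x).integrable
  exact ((((h1.comp_fst _).const_mul a).add (integrable_const _)).add
    ((integrable_inner_sub_est hest hx hn).const_mul b)).add
    (((integrable_norm_sub_sq hest hx hn).comp_fst _).const_mul _)

theorem integral_logLikelihoodRatio (hest : Measurable est) (hx : ‖x‖ = 1)
    (hn : ∀ y, ‖est y‖ = 1) :
    ∫ w, logLikelihoodRatio a b est x w
      ∂((stdGaussian (EuclideanSpace ℝ κ)).prod (stdGaussian (EuclideanSpace ℝ κ))) =
    a ^ 2 / 2 + b ^ 2 / 2 *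
      ∫ z, ‖x - est (a • x + z)‖ ^ 2 ∂(stdGaussian (EuclideanSpace ℝ κ)) := by
  have h1 : Integrable (fun z => (inner ℝ x z : ℝ)) (stdGaussian (EuclideanSpace ℝ κ)) :=
    (hasSubgaussianMGF_inner_stdGaussian x).integrable
  have i1 : Integrable (fun w : EuclideanSpace ℝ κ × EuclideanSpace ℝ κ =>
      a * (inner ℝ x w.1 : ℝ))
      ((stdGaussian (EuclideanSpace ℝ κ)).prod (stdGaussian (EuclideanSpace ℝ κ))) :=
    (h1.comp_fst _).const_mul a
  have i2 := (integrable_inner_sub_est (a := a) hest hx hn).const_mul b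
  have i3 : Integrable (fun w : EuclideanSpace ℝ κ × EuclideanSpace ℝ κ =>
      b ^ 2 / 2 * ‖x - est (a • x + w.1)‖ ^ 2)
      ((stdGaussian (EuclideanSpace ℝ κ)).prod (stdGaussian (EuclideanSpace ℝ κ))) :=
    ((integrable_norm_sub_sq (a := a) hest hx hn).comp_fst _).const_mul _
  have i4 := i1.add (integrable_const (a ^ 2 / 2))
  have hsplit := integral_add (i4.add i2) i3
  have hsplit' := integral_add i4 i2
  have hsplit'' := integral_add i1 (integrable_const (a ^ 2 / 2))
  simp only [Pi.add_apply] at hsplit hsplit' hsplit''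
  simp only [logLikelihoodRatio]
  rw [hsplit, hsplit', hsplit'']
  have e1 : ∫ w : EuclideanSpace ℝ κ × EuclideanSpace ℝ κ, a * (inner ℝ x w.1 : ℝ)
      ∂((stdGaussian (EuclideanSpace ℝ κ)).prod (stdGaussian (EuclideanSpace ℝ κ))) = 0 := by
    rw [integral_prod _ i1]
    simp [integral_const_mul, integral_inner_stdGaussian]
  have e2 : ∫ w : EuclideanSpace ℝ κ × EuclideanSpace ℝ κ,
      b * (inner ℝ (x - est (a • x + w.1)) w.2 : ℝ)
      ∂((stdGaussian (EuclideanSpace ℝ κ)).prod (stdGaussian (EuclideanSpace ℝ κ))) = 0 := by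
    rw [integral_prod _ i2]
    simp [integral_const_mul, integral_inner_stdGaussian]
  have e3 : ∫ w : EuclideanSpace ℝ κ × EuclideanSpace ℝ κ,
      b ^ 2 / 2 * ‖x - est (a • x + w.1)‖ ^ 2
      ∂((stdGaussian (EuclideanSpace ℝ κ)).prod (stdGaussian (EuclideanSpace ℝ κ))) =
      b ^ 2 / 2 * ∫ z, ‖x - est (a • x + z)‖ ^ 2 ∂(stdGaussian (EuclideanSpace ℝ κ)) := by
    rw [integral_prod _ i3]
    simp [integral_const_mul]
  rw [e1, e2, e3]
  simp

/-- Decoding from two observations bounds from below the mean square error of an estimator based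
on the first one. -/
theorem decoding_le_mean_square_error {ι : Type*} [Fintype ι] [Nonempty ι]
    {X : ι → EuclideanSpace ℝ κ} (hX : ∀ i, ‖X i‖ = 1) (hest : Measurable est)
    (hn : ∀ y, ‖est y‖ = 1) {D : EuclideanSpace ℝ κ × EuclideanSpace ℝ κ → ι}
    (hD : ∀ i, MeasurableSet (D ⁻¹' {i})) :
    (∑ i, ((stdGaussian (EuclideanSpace ℝ κ)).prod (stdGaussian (EuclideanSpace ℝ κ))).real
        {w | D (a • X i + w.1, b • X i + w.2) = i}) * Real.log (Fintype.card ι) ≤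
      Fintype.card ι * (Real.log 2 + a ^ 2 / 2) + b ^ 2 / 2 *
        ∑ i, ∫ z, ‖X i - est (a • X i + z)‖ ^ 2 ∂(stdGaussian (EuclideanSpace ℝ κ)) := by
  set Γ := (stdGaussian (EuclideanSpace ℝ κ)).prod (stdGaussian (EuclideanSpace ℝ κ))
  set M : ℝ := (Fintype.card ι : ℝ)
  have hM : 1 ≤ M := by exact Nat.one_le_cast.2 Fintype.card_pos
  let U : ι → Set (EuclideanSpace ℝ κ × EuclideanSpace ℝ κ) :=
    fun i => {w | D (a • X i + w.1, b • X i + w.2) = i}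
  have hU (i : ι) : MeasurableSet (U i) :=
    (hD i).preimage (f := fun w : EuclideanSpace ℝ κ × EuclideanSpace ℝ κ =>
      (a • X i + w.1, b • X i + w.2)) (by fun_prop)
  let L : ι → EuclideanSpace ℝ κ × EuclideanSpace ℝ κ → ℝ :=
    fun i => logLikelihoodRatio a b est (X i)
  let q : ι → ℝ := fun i => ∫ w in U i, Real.exp (-L i w) ∂Γ
  have hLint (i : ι) : Integrable (fun w => Real.exp (-L i w)) Γ :=
    integrable_exp_neg_logLikelihoodRatio hest (hX i)
  have hone (i : ι) : ∫ w, Real.exp (-L i w) ∂Γ = 1 := by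
    rw [integral_eq_lintegral_of_nonneg_ae (ae_of_all _ fun w => (Real.exp_pos _).le)
      (hLint i).aestronglyMeasurable]
    have := lintegral_exp_neg_logLikelihoodRatio_mul (a := a) (b := b) hest (hX i)
      (G := fun _ => 1) measurable_const
    simp only [mul_one, lintegral_const, measure_univ] at this
    rw [this, ENNReal.toReal_one]
  let V : ι → Set (EuclideanSpace ℝ κ × EuclideanSpace ℝ κ) :=
    fun i => {w | D (w.1, b • est w.1 + w.2) = i}
  have hV (i : ι) : MeasurableSet (V i) :=
    (hD i).preimage (f := fun w : EuclideanSpace ℝ κ × EuclideanSpace ℝ κ =>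
      (w.1, b • est w.1 + w.2)) (by fun_prop)
  have hqV (i : ι) : q i = Γ.real (V i) := by
    simp only [q]
    rw [integral_eq_lintegral_of_nonneg_ae (ae_of_all _ fun w => (Real.exp_pos _).le)
      (hLint i).integrableOn.aestronglyMeasurable, Measure.real]
    congr 1
    have := lintegral_exp_neg_logLikelihoodRatio_mul (a := a) (b := b) hest (hX i)
      (G := (D ⁻¹' {i}).indicator fun _ => 1) (measurable_const.indicator (hD i))
    rw [← lintegral_indicator (hU i), ← lintegral_indicator_one (hV i)]
    refine Eq.trans (lintegral_congr fun w => ?_) this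
    by_cases hw : w ∈ U i
    · have hw' : (a • X i + w.1, b • X i + w.2) ∈ D ⁻¹' {i} := hw
      rw [Set.indicator_of_mem hw, Set.indicator_of_mem hw', mul_one]
    · have hw' : (a • X i + w.1, b • X i + w.2) ∉ D ⁻¹' {i} := hw
      rw [Set.indicator_of_notMem hw, Set.indicator_of_notMem hw', mul_zero]
  -- `q i` is the probability of decoding `i` under the reference law, the same for every `i`, and
  -- these events are disjoint.
  have hq : ∑ i, q i ≤ 1 := by
    simp_rw [hqV]
    rw [← measureReal_biUnion_finset (fun i _ j _ hij => ?_) fun i _ => hV i]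
    · exact measureReal_le_one
    · exact Set.disjoint_left.2 fun w hi hj => hij (Eq.trans (Eq.symm hi) hj)
  have key (i : ι) : Real.log M * Γ.real (U i) - (a ^ 2 / 2 + b ^ 2 / 2 *
      ∫ z, ‖X i - est (a • X i + z)‖ ^ 2 ∂(stdGaussian (EuclideanSpace ℝ κ))) - Real.log 2 + 1 ≤
      1 / 2 * (M * q i + 1) := by
    have hLi : Integrable (L i) Γ := integrable_logLikelihoodRatio hest (hX i) hn
    have hind : Integrable ((U i).indicator fun _ => Real.log M) Γ :=
      (integrable_const _).indicator (hU i)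
    have hmul : Integrable (fun w => M * (U i).indicator (fun w => Real.exp (-L i w)) w) Γ :=
      ((hLint i).indicator (hU i)).const_mul M
    have hmono : ∫ w, ((U i).indicator (fun _ => Real.log M) w - L i w + (1 - Real.log 2)) ∂Γ ≤
        ∫ w, 1 / 2 * (M * (U i).indicator (fun w => Real.exp (-L i w)) w + Real.exp (-L i w))
          ∂Γ := by
      refine integral_mono ((hind.sub hLi).add (integrable_const _))
        ((hmul.add (hLint i)).const_mul _) fun w => ?_
      -- A variational entropy bound with test function log M on `U i` and 0 elsewhere. Under the
      -- reference law M^(1_U) ≤ M 1_U + 1 has average expectation at most 2 over the signals, and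
      -- the shift by log 2 normalizes this.
      have hexp := Real.add_one_le_exp
        ((U i).indicator (fun _ => Real.log M) w - L i w - Real.log 2)
      rw [Real.exp_sub, Real.exp_log two_pos, sub_eq_add_neg _ (L i w), Real.exp_add] at hexp
      have hpos := Real.exp_pos (-L i w)
      by_cases hw : w ∈ U i
      · simp only [Set.indicator_of_mem hw, Real.exp_log (zero_lt_one.trans_le hM)] at hexp ⊢
        linarith
      · simp only [Set.indicator_of_notMem hw, Real.exp_zero] at hexp ⊢
        linarith
    have hadd := integral_add (hind.sub hLi) (integrable_const (1 - Real.log 2))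
    have hsub := integral_sub hind hLi
    simp only [Pi.sub_apply] at hadd hsub
    rw [hadd, hsub, integral_indicator_const _ (hU i), integral_const, probReal_univ, integral_const_mul,
      integral_add hmul (hLint i), integral_const_mul, integral_indicator (hU i), hone i,
      integral_logLikelihoodRatio hest (hX i) hn] at hmono
    simp only [smul_eq_mul] at hmono
    linarith
  have hsum := Finset.sum_le_sum fun i (_ : i ∈ Finset.univ) => key i
  simp only [Finset.sum_add_distrib, Finset.sum_sub_distrib, ← Finset.mul_sum, Finset.sum_const,
    Finset.card_univ, nsmul_eq_mul, mul_one] at hsum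
  have : M * ∑ i, q i ≤ M * 1 := by gcongr
  simp only [U] at hsum
  linarith

end TwoObservations

/-! ### The prior as an average over supports. -/

section Prior

theorem mem_binarySphere_iff {p k : ℕ} (hk : 1 ≤ k) (x : EuclideanSpace ℝ (Fin p)) :
    x ∈ binarySphere (Fin p) k ↔ ∃ S : Finset (Fin p), S.card = k ∧
      (WithLp.toLp 2 fun i => if i ∈ S then 1 / Real.sqrt k else 0) = x := by
  classical
  have hk' : (0 : ℝ) < k := by exact_mod_cast hk
  have hne : 1 / Real.sqrt k ≠ 0 := by positivity
  have hnorm (S : Finset (Fin p)) :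
      ‖(WithLp.toLp 2 fun i => if i ∈ S then 1 / Real.sqrt k else 0 : EuclideanSpace ℝ (Fin p))‖ ^ 2
        = S.card / k := by
    rw [EuclideanSpace.real_norm_sq_eq]
    simp [ite_pow, Finset.sum_ite_mem, Real.sq_sqrt hk'.le, div_eq_mul_inv]
  constructor
  · rintro ⟨h, hn⟩
    let S : Finset (Fin p) := Finset.univ.filter fun i => x i ≠ 0
    have hx : (WithLp.toLp 2 fun i => if i ∈ S then 1 / Real.sqrt k else 0) = x := by
      ext i
      rcases h i with h0 | h1
      · simp [S, h0]
      · have : i ∈ S := by simp only [S, Finset.mem_filter_univ]; rw [h1]; exact hne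
        simp only [this, if_true]
        exact h1.symm
    refine ⟨S, ?_, hx⟩
    have h2 := hnorm S
    rw [hx, mem_sphere_zero_iff_norm.1 hn, one_pow, eq_div_iff hk'.ne', one_mul] at h2
    exact_mod_cast h2.symm
  · rintro ⟨S, hS, rfl⟩
    refine ⟨fun i => ?_, ?_⟩
    · by_cases h : i ∈ S <;> simp [h]
    · have h2 := hnorm S
      rw [hS, div_self hk'.ne'] at h2
      exact mem_sphere_zero_iff_norm.2 ((pow_eq_one_iff_of_nonneg (norm_nonneg _) two_ne_zero).1 h2)

theorem lintegral_signalPrior (d : ℕ) {p k : ℕ} (hk : 1 ≤ k) {f : Tensor d p → ℝ≥0∞}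
    (hf : Measurable f) :
    ∫⁻ x, f x ∂(signalPrior d p k) =
      (p.choose k : ℝ≥0∞)⁻¹ * ∑ S : {S : Finset (Fin p) // S.card = k}, f (codeword d k S.1) := by
  classical
  let v : {S : Finset (Fin p) // S.card = k} → EuclideanSpace ℝ (Fin p) :=
    fun S => WithLp.toLp 2 fun i => if i ∈ S.1 then 1 / Real.sqrt k else 0
  have hk' : (0 : ℝ) < k := by exact_mod_cast hk
  have hv : Function.Injective v := by
    intro S T hST
    apply Subtype.ext
    ext i
    have h := congrArg (fun x : EuclideanSpace ℝ (Fin p) => x i) hST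
    have hne : (Real.sqrt k)⁻¹ ≠ 0 := by positivity
    have hne' : (0 : ℝ) ≠ (Real.sqrt k)⁻¹ := hne.symm
    by_cases hS : i ∈ S.1 <;> by_cases hT : i ∈ T.1 <;> simp [v, hS, hT, hne, hne'] at h ⊢
  have hs : binarySphere (Fin p) k = ((Finset.univ.map ⟨v, hv⟩ : Finset _) : Set _) := by
    ext x
    rw [mem_binarySphere_iff hk]
    simp only [Finset.coe_map, Finset.coe_univ, Set.image_univ, Set.mem_range, Subtype.exists,
      Function.Embedding.coeFn_mk, v]
    exact exists_congr fun S => exists_prop.symm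
  have hm : Measurable (tensorPower d (p := p)) := by
    unfold tensorPower
    fun_prop
  rw [signalPrior, lintegral_map hf hm, uniformOn, ProbabilityTheory.cond, lintegral_smul_measure, hs,
    lintegral_finset, Measure.count_apply_finset, Finset.card_map, Finset.card_univ,
    Fintype.card_finset_len, Fintype.card_fin, smul_eq_mul, Finset.sum_map]
  simp only [Measure.count_singleton, mul_one]
  rfl

theorem meanSquareError_eq (d : ℕ) {p k : ℕ} (hk : 1 ≤ k) (l : ℝ) {est : Tensor d p → Tensor d p}
    (hest : Measurable est) :
    meanSquareError d p k l est = (p.choose k : ℝ≥0∞)⁻¹ *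
      ∑ S : {S : Finset (Fin p) // S.card = k}, ∫⁻ z,
        ‖codeword d k S.1 - est (Real.sqrt l • codeword d k S.1 + z)‖ₑ ^ 2
          ∂(stdGaussian (Tensor d p)) := by
  rw [meanSquareError, lintegral_prod _ (Measurable.aemeasurable (by fun_prop))]
  exact lintegral_signalPrior d hk (f := fun x => ∫⁻ z, ‖x - est (Real.sqrt l • x + z)‖ₑ ^ 2
    ∂(stdGaussian (Tensor d p))) (Measurable.lintegral_prod_right'
      (f := fun w : Tensor d p × Tensor d p => ‖w.1 - est (Real.sqrt l • w.1 + w.2)‖ₑ ^ 2)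
      (by fun_prop))

theorem meanSquareError_eq_ofReal (d : ℕ) {p k : ℕ} (hk : 1 ≤ k) (hkp : k ≤ p) (l : ℝ)
    {est : Tensor d p → Tensor d p} (hest : Measurable est) (hn : ∀ y, ‖est y‖ = 1) :
    meanSquareError d p k l est = ENNReal.ofReal ((p.choose k : ℝ)⁻¹ *
      ∑ S : {S : Finset (Fin p) // S.card = k}, ∫ z,
        ‖codeword d k S.1 - est (Real.sqrt l • codeword d k S.1 + z)‖ ^ 2
          ∂(stdGaussian (Tensor d p))) := by
  have hM : (0 : ℝ) < p.choose k := by exact_mod_cast Nat.choose_pos hkp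
  rw [meanSquareError_eq d hk l hest, ENNReal.ofReal_mul (by positivity),
    ENNReal.ofReal_inv_of_pos hM, ENNReal.ofReal_natCast,
    ENNReal.ofReal_sum_of_nonneg fun S _ => integral_nonneg fun z => by positivity]
  congr 1
  refine Finset.sum_congr rfl fun S _ => ?_
  rw [ofReal_integral_eq_lintegral_ofReal
    (integrable_norm_sub_sq hest (norm_codeword d hk S.2) hn) (ae_of_all _ fun z => by positivity)]
  refine lintegral_congr fun z => ?_
  rw [ENNReal.ofReal_pow (norm_nonneg _), ofReal_norm]

end Prior

/-! ### Decoding error for the tensor code. -/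

section DecodingError

/-- Bound for the error probability of maximum likelihood decoding of the codewords at
signal-to-noise ratio `B * criticalSnr p k`. -/
noncomputable def decodingErrorBound (B ε : ℝ) (p k : ℕ) : ℝ :=
  Real.exp (-(ε ^ 2 * B * Real.log (p.choose k))) +
    2 * (k * p * Real.exp (-((1 - ε) ^ 2 * B * Real.log (p.choose k) / k)))

theorem codeword_decoding_error_le {d p k : ℕ} (hd : 2 ≤ d) (hk : 1 ≤ k) {Ω : Type*}
    [MeasurableSpace Ω] {μ : Measure Ω} [IsProbabilityMeasure μ] {W : Ω → Tensor d p}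
    (hW : ∀ v : Tensor d p, HasSubgaussianMGF (fun ω => inner ℝ v (W ω)) (‖v‖₊ ^ 2) μ)
    (S : {S : Finset (Fin p) // S.card = k}) {B ε : ℝ} (hB : 0 ≤ B) (hε0 : 0 ≤ ε) (hε1 : ε ≤ 1)
    (hsmall : k * p * Real.exp (-((1 - ε) ^ 2 * B * Real.log (p.choose k) / k)) ≤ 1 / 2) :
    μ.real {ω | ∃ T : {S : Finset (Fin p) // S.card = k}, T ≠ S ∧
        (inner ℝ (codeword d k S.1) (Real.sqrt (B * criticalSnr p k) • codeword d k S.1 + W ω) : ℝ)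
          ≤ inner ℝ (codeword d k T.1)
            (Real.sqrt (B * criticalSnr p k) • codeword d k S.1 + W ω)} ≤
      decodingErrorBound B ε p k := by
  have hk' : (0 : ℝ) < k := by exact_mod_cast hk
  have hlog : 0 ≤ Real.log (p.choose k) := Real.log_natCast_nonneg _
  have hsnr : 0 ≤ B * criticalSnr p k := by unfold criticalSnr; positivity
  have hsq : Real.sqrt (B * criticalSnr p k) ^ 2 = B * (2 * Real.log (p.choose k)) :=
    Real.sq_sqrt hsnr
  refine (decoding_error_le hW (X := fun S : {S : Finset (Fin p) // S.card = k} =>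
    codeword d k S.1) (fun T => norm_codeword d hk T.2) S
    (fun T => inner_codeword_nonneg d k _ _)
    (fun T hT => inner_codeword_lt_one (by omega) S.2 T.2 fun h => hT (Subtype.ext h))
    hε0 hε1 (Real.sqrt_nonneg _)).trans ?_
  unfold decodingErrorBound
  refine add_le_add (le_of_eq ?_) ?_
  · rw [mul_pow, hsq]; ring_nf
  · rw [mul_pow, hsq]
    set y := Real.exp (-((1 - ε) ^ 2 * B * Real.log (p.choose k) / k)) with hy
    refine le_trans ?_ (sum_pow_sub_card_inter_le S.2 (Real.exp_pos _).le hsmall)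
    have hre : ∑ T ∈ (Finset.univ : Finset {S : Finset (Fin p) // S.card = k}).erase S,
        y ^ (k - (S.1 ∩ T.1).card) =
        ∑ T ∈ (Finset.univ.powersetCard k).erase S.1, y ^ (k - (S.1 ∩ T).card) := by
      refine Finset.sum_nbij (fun T => T.1) ?_ ?_ ?_ fun _ _ => rfl
      · intro T hT
        simpa [Finset.mem_powersetCard, T.2, Subtype.ext_iff] using hT
      · exact fun T _ T' _ h => Subtype.ext h
      · intro T hT
        simp only [Finset.coe_erase, Set.mem_sdiff, Finset.mem_coe, Finset.mem_powersetCard,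
          Set.mem_singleton_iff] at hT
        exact ⟨⟨T, hT.1.2⟩, by simpa [Subtype.ext_iff] using hT.2, rfl⟩
    rw [← hre]
    refine Finset.sum_le_sum fun T _ => ?_
    have hcard : (S.1 ∩ T.1).card ≤ k :=
      (Finset.card_le_card Finset.inter_subset_left).trans_eq S.2
    rw [hy, ← Real.exp_nat_mul, Real.exp_le_exp, Nat.cast_sub hcard, inner_codeword]
    set c : ℝ := ((S.1 ∩ T.1).card : ℝ)
    have hck : c ≤ k := Nat.cast_le.2 hcard
    have h := one_sub_le_one_sub_pow_div hd (t := c / k) (by positivity) ((div_le_one hk').2 hck)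
    have h2 : (1 - ε) ^ 2 * B * Real.log (p.choose k) * (1 - c / k) ≤
        (1 - ε) ^ 2 * B * Real.log (p.choose k) * ((1 - (c / k) ^ d) / (1 + (c / k) ^ d)) := by
      gcongr
    have e : (k - c) * -((1 - ε) ^ 2 * B * Real.log (p.choose k) / k) =
        -((1 - ε) ^ 2 * B * Real.log (p.choose k) * (1 - c / k)) := by
      field_simp
    rw [e]
    linarith

end DecodingError

/-! ### Asymptotics of binom(p, k) and of the error bound. -/

section Asymptotics

variable {d : ℕ} {k : ℕ → ℕ}

/-- Sparsity acts through k being smaller than every positive power of p; then binom(p, k) ≥ ((p + 1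
- k)/k)^k ≥ p^((1 - η)k). -/
theorem eventually_le_rpow_and_le_log_choose (hk_pos : ∀ᶠ p in atTop, 1 ≤ k p)
    (hk : (fun p : ℕ => (k p : ℝ)) =o[atTop]
      fun p : ℕ => (Real.log (p : ℝ)) ^ (1 / (2 * (d : ℝ) - 1)))
    {η : ℝ} (hη0 : 0 < η) (hη1 : η < 1) :
    ∀ᶠ p : ℕ in atTop, k p ≤ p ∧ (k p : ℝ) ≤ (p : ℝ) ^ η ∧
      k p * ((1 - η) * Real.log p) ≤ Real.log (p.choose (k p)) := by
  have h1 : (fun p : ℕ => (k p : ℝ)) =o[atTop] fun p : ℕ => (p : ℝ) ^ η :=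
    hk.trans ((isLittleO_log_rpow_rpow_atTop _ hη0).comp_tendsto tendsto_natCast_atTop_atTop)
  -- The factor 1/2 in k ≤ p^η / 2 absorbs the loss in p + 1 - k ≥ p/2.
  filter_upwards [hk_pos, h1.bound (show (0 : ℝ) < 1 / 2 by norm_num), eventually_ge_atTop 1]
    with p hkp hb hp
  have hp' : (1 : ℝ) ≤ p := by exact_mod_cast hp
  have hk' : (1 : ℝ) ≤ k p := by exact_mod_cast hkp
  have hpη : 0 < (p : ℝ) ^ η := by positivity
  rw [Real.norm_of_nonneg (by positivity), Real.norm_of_nonneg hpη.le] at hb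
  have hle : (p : ℝ) ^ η ≤ p := by
    simpa using Real.rpow_le_rpow_of_exponent_le hp' hη1.le
  have hkle : k p ≤ p := by
    have : (k p : ℝ) ≤ p := by linarith
    exact_mod_cast this
  refine ⟨hkle, by linarith, ?_⟩
  have hchoose := Nat.pow_le_choose (α := ℝ) (k p) p
  have hfac : ((k p).factorial : ℝ) ≤ (k p : ℝ) ^ k p := by
    exact_mod_cast Nat.factorial_le_pow (k p)
  have hbase : (p : ℝ) / 2 ≤ ((p + 1 - k p : ℕ) : ℝ) := by
    rw [Nat.cast_sub (by omega)]
    push_cast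
    linarith
  have hrat : (p : ℝ) ^ (1 - η) ≤ ((p + 1 - k p : ℕ) : ℝ) / k p := by
    rw [le_div_iff₀ (by linarith), Real.rpow_sub (by linarith), Real.rpow_one]
    calc (p : ℝ) / p ^ η * k p ≤ p / p ^ η * (1 / 2 * p ^ η) := by gcongr
      _ = p / 2 := by field_simp
      _ ≤ _ := hbase
  have hpow : ((p : ℝ) ^ (1 - η)) ^ k p ≤ p.choose (k p) := by
    calc ((p : ℝ) ^ (1 - η)) ^ k p ≤ (((p + 1 - k p : ℕ) : ℝ) / k p) ^ k p := by gcongr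
      _ = ((p + 1 - k p : ℕ) : ℝ) ^ k p / (k p : ℝ) ^ k p := div_pow _ _ _
      _ ≤ ((p + 1 - k p : ℕ) : ℝ) ^ k p / (k p).factorial := by gcongr
      _ ≤ _ := by exact_mod_cast hchoose
  have hl := Real.log_le_log (by positivity) hpow
  rwa [Real.log_pow, Real.log_rpow (by linarith)] at hl

theorem tendsto_log_choose (hk_pos : ∀ᶠ p in atTop, 1 ≤ k p)
    (hk : (fun p : ℕ => (k p : ℝ)) =o[atTop]
      fun p : ℕ => (Real.log (p : ℝ)) ^ (1 / (2 * (d : ℝ) - 1))) :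
    Tendsto (fun p : ℕ => Real.log (p.choose (k p))) atTop atTop := by
  have h1 : Tendsto (fun p : ℕ => (1 - 1 / 2 : ℝ) * Real.log p) atTop atTop :=
    (Real.tendsto_log_atTop.comp tendsto_natCast_atTop_atTop).const_mul_atTop (by norm_num)
  refine tendsto_atTop_mono' _ ?_ h1
  filter_upwards [hk_pos, eventually_ge_atTop 1, eventually_le_rpow_and_le_log_choose hk_pos hk
    (η := 1 / 2) (by norm_num) (by norm_num)] with p hkp hp h
  have hlog : 0 ≤ Real.log p := Real.log_natCast_nonneg _
  have hk' : (1 : ℝ) ≤ k p := by exact_mod_cast hkp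
  nlinarith [h.2.2, mul_nonneg (sub_nonneg.2 hk') hlog]

theorem tendsto_mul_exp_neg_log_choose_div (hk_pos : ∀ᶠ p in atTop, 1 ≤ k p)
    (hk : (fun p : ℕ => (k p : ℝ)) =o[atTop]
      fun p : ℕ => (Real.log (p : ℝ)) ^ (1 / (2 * (d : ℝ) - 1)))
    {b : ℝ} (hb : 1 < b) :
    Tendsto (fun p : ℕ => k p * p * Real.exp (-(b * Real.log (p.choose (k p)) / k p))) atTop
      (𝓝 0) := by
  -- Chosen so that the final exponent η + 1 - b(1 - η) equals -(b - 1)/2.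
  set η : ℝ := (b - 1) / (2 * (1 + b)) with hη
  have hη0 : 0 < η := by rw [hη]; apply div_pos <;> linarith
  have hη1 : η < 1 := by rw [hη, div_lt_one] <;> linarith
  have hη2 : η * (1 + b) = (b - 1) / 2 := by rw [hη]; field_simp
  have h0 : Tendsto (fun p : ℕ => (p : ℝ) ^ (-((b - 1) / 2))) atTop (𝓝 0) :=
    (tendsto_rpow_neg_atTop (by linarith)).comp tendsto_natCast_atTop_atTop
  refine squeeze_zero' (Eventually.of_forall fun p => by positivity) ?_ h0
  filter_upwards [hk_pos, eventually_ge_atTop 1, eventually_le_rpow_and_le_log_choose hk_pos hk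
    hη0 hη1] with p hkp hp h
  have hk' : (0 : ℝ) < k p := by exact_mod_cast hkp
  have hp' : (0 : ℝ) < p := by exact_mod_cast hp
  have hexp : Real.exp (-(b * Real.log (p.choose (k p)) / k p)) ≤ (p : ℝ) ^ (-(b * (1 - η))) := by
    rw [Real.rpow_def_of_pos hp', Real.exp_le_exp, mul_neg, neg_le_neg_iff, le_div_iff₀ hk']
    nlinarith [h.2.2]
  calc k p * p * Real.exp (-(b * Real.log (p.choose (k p)) / k p))
      ≤ (p : ℝ) ^ η * (p : ℝ) ^ (1 : ℝ) * (p : ℝ) ^ (-(b * (1 - η))) := by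
        rw [Real.rpow_one]
        gcongr
        exact h.2.1
    _ = (p : ℝ) ^ (-((b - 1) / 2)) := by
        rw [← Real.rpow_add hp', ← Real.rpow_add hp']
        congr 1
        linarith

theorem tendsto_decodingErrorBound (hk_pos : ∀ᶠ p in atTop, 1 ≤ k p)
    (hk : (fun p : ℕ => (k p : ℝ)) =o[atTop]
      fun p : ℕ => (Real.log (p : ℝ)) ^ (1 / (2 * (d : ℝ) - 1)))
    {B ε : ℝ} (hB : 0 < B) (hε : 0 < ε) (hεB : 1 < (1 - ε) ^ 2 * B) :
    Tendsto (fun p => decodingErrorBound B ε p (k p)) atTop (𝓝 0) := by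
  have h1 : Tendsto (fun p : ℕ => Real.exp (-(ε ^ 2 * B * Real.log (p.choose (k p))))) atTop
      (𝓝 0) :=
    Real.tendsto_exp_neg_atTop_nhds_zero.comp
      ((tendsto_log_choose hk_pos hk).const_mul_atTop (by positivity))
  have h2 := (tendsto_mul_exp_neg_log_choose_div hk_pos hk hεB).const_mul 2
  simpa [decodingErrorBound] using h1.add h2

theorem exists_margin {B : ℝ} (hB : 1 < B) : ∃ ε : ℝ, 0 < ε ∧ ε ≤ 1 ∧ 1 < (1 - ε) ^ 2 * B := by
  -- With this ε, (1 - ε)²B = (B + 1)²/(4B), which exceeds 1 since (B - 1)² > 0.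
  refine ⟨(B - 1) / (2 * B), by apply div_pos <;> linarith, ?_, ?_⟩
  · rw [div_le_one (by linarith)]; linarith
  · have e : (1 - (B - 1) / (2 * B)) ^ 2 * B = (B + 1) ^ 2 / (4 * B) := by
      field_simp; ring
    rw [e, lt_div_iff₀ (by linarith)]
    nlinarith

end Asymptotics

/-! ### Above the threshold: the decoder as an estimator. -/

section Achievability

theorem cmmse_le_decodingErrorBound {d p k : ℕ} (hd : 2 ≤ d) (hk : 1 ≤ k) (hkp : k ≤ p) {B ε : ℝ}
    (hB : 0 ≤ B) (hε0 : 0 ≤ ε) (hε1 : ε ≤ 1)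
    (hsmall : k * p * Real.exp (-((1 - ε) ^ 2 * B * Real.log (p.choose k) / k)) ≤ 1 / 2) :
    cmmse d p k (B * criticalSnr p k) ≤ ENNReal.ofReal (4 * decodingErrorBound B ε p k) := by
  classical
  have hne : Nonempty {S : Finset (Fin p) // S.card = k} := by
    rw [← Fintype.card_pos_iff, Fintype.card_finset_len, Fintype.card_fin]
    exact Nat.choose_pos hkp
  have hM : (0 : ℝ) < p.choose k := by exact_mod_cast Nat.choose_pos hkp
  obtain ⟨D, hD, hdec⟩ := exists_measurable_decoder
    (fun S : {S : Finset (Fin p) // S.card = k} => codeword d k S.1)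
  let est : Tensor d p → Tensor d p := fun y => codeword d k (D y).1
  have hest : Measurable est := by
    let _ : MeasurableSpace {S : Finset (Fin p) // S.card = k} := ⊤
    have hDm : Measurable D := measurable_to_countable' hD
    exact (measurable_from_top (f := fun S : {S : Finset (Fin p) // S.card = k} =>
      codeword d k S.1)).comp hDm
  have hn (y : Tensor d p) : ‖est y‖ = 1 := norm_codeword d hk (D y).2
  refine (iInf₂_le est hest).trans ((iInf_le _ fun y =>
    codeword_mem_binarySphere d hk (D y).2).trans ?_)
  rw [meanSquareError_eq_ofReal d hk hkp _ hest hn]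
  refine ENNReal.ofReal_le_ofReal ?_
  have hterm (S : {S : Finset (Fin p) // S.card = k}) :
      ∫ z, ‖codeword d k S.1 -
        est (Real.sqrt (B * criticalSnr p k) • codeword d k S.1 + z)‖ ^ 2
          ∂(stdGaussian (Tensor d p)) ≤ 4 * decodingErrorBound B ε p k := by
    let F : Set (Tensor d p) :=
      {z | D (Real.sqrt (B * criticalSnr p k) • codeword d k S.1 + z) = S}ᶜ
    have hF : MeasurableSet F := ((hD S).preimage
      (f := fun z => Real.sqrt (B * criticalSnr p k) • codeword d k S.1 + z) (by fun_prop)).compl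
    have herr := codeword_decoding_error_le hd hk (W := fun z : Tensor d p => z)
      hasSubgaussianMGF_inner_stdGaussian S hB hε0 hε1 hsmall
    have hFle : (stdGaussian (Tensor d p)).real F ≤ decodingErrorBound B ε p k := by
      refine (measureReal_mono fun z hz => ?_).trans herr
      by_contra hc
      simp only [Set.mem_ofPred_eq, not_exists, not_and, not_le] at hc
      exact hz (hdec S _ hc)
    -- The loss is 0 on correct decoding, and two unit vectors are at squared distance at most 4.
    calc _ ≤ ∫ z, F.indicator (fun _ => (4 : ℝ)) z ∂(stdGaussian (Tensor d p)) := by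
          refine integral_mono (integrable_norm_sub_sq hest (norm_codeword d hk S.2) hn)
            ((integrable_const _).indicator hF) fun z => ?_
          by_cases hz : z ∈ F
          · have h := norm_sub_le (codeword d k S.1)
              (est (Real.sqrt (B * criticalSnr p k) • codeword d k S.1 + z))
            rw [norm_codeword d hk S.2, hn] at h
            simp only [Set.indicator_of_mem hz]
            nlinarith [norm_nonneg (codeword d k S.1 -
              est (Real.sqrt (B * criticalSnr p k) • codeword d k S.1 + z))]
          · have h : D (Real.sqrt (B * criticalSnr p k) • codeword d k S.1 + z) = S := not_not.1 hz
            simp [Set.indicator_of_notMem hz, est, h]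
      _ = 4 * (stdGaussian (Tensor d p)).real F := by
          rw [integral_indicator_const _ hF, smul_eq_mul, mul_comm]
      _ ≤ _ := by gcongr
  have hsum := Finset.sum_le_sum fun S (_ : S ∈ Finset.univ) => hterm S
  rw [Finset.sum_const, Finset.card_univ, Fintype.card_finset_len, Fintype.card_fin,
    nsmul_eq_mul] at hsum
  rw [inv_mul_le_iff₀ hM]
  exact hsum

end Achievability

/-! ### Below the threshold: the adjoined observation. -/

section Converse

/-- An estimator at signal-to-noise ratio below `B * criticalSnr p k`, a level at which decoding
succeeds, has a mean square error bounded from below. -/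
theorem meanSquareError_lower_bound_of_decoding {d p k : ℕ} (hd : 2 ≤ d) (hk : 1 ≤ k) (hkp : k ≤ p)
    (hlog : 0 < Real.log (p.choose k)) {β B ε : ℝ} (hβ : 0 ≤ β) (hβB : β < B) (hε0 : 0 ≤ ε)
    (hε1 : ε ≤ 1)
    (hsmall : k * p * Real.exp (-((1 - ε) ^ 2 * B * Real.log (p.choose k) / k)) ≤ 1 / 2)
    {est : Tensor d p → Tensor d p} (hest : Measurable est) (hn : ∀ y, ‖est y‖ = 1) :
    1 - decodingErrorBound B ε p k - β - Real.log 2 / Real.log (p.choose k) ≤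
      (B - β) * ((p.choose k : ℝ)⁻¹ * ∑ S : {S : Finset (Fin p) // S.card = k}, ∫ z,
        ‖codeword d k S.1 - est (Real.sqrt (β * criticalSnr p k) • codeword d k S.1 + z)‖ ^ 2
          ∂(stdGaussian (Tensor d p))) := by
  classical
  have hcard : Fintype.card {S : Finset (Fin p) // S.card = k} = p.choose k := by
    rw [Fintype.card_finset_len, Fintype.card_fin]
  have hne : Nonempty {S : Finset (Fin p) // S.card = k} := by
    rw [← Fintype.card_pos_iff, hcard]
    exact Nat.choose_pos hkp
  have hM : (0 : ℝ) < p.choose k := by exact_mod_cast Nat.choose_pos hkp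
  have hsnr : 0 < criticalSnr p k := by unfold criticalSnr; positivity
  have hB : 0 < B := hβ.trans_lt hβB
  set a := Real.sqrt (β * criticalSnr p k)
  set b := Real.sqrt ((B - β) * criticalSnr p k)
  set s := Real.sqrt (B * criticalSnr p k) with hs_def
  have hs : 0 < s := Real.sqrt_pos.2 (by positivity)
  have ha2 : a ^ 2 = β * criticalSnr p k := Real.sq_sqrt (by positivity)
  have hb2 : b ^ 2 = (B - β) * criticalSnr p k :=
    Real.sq_sqrt (mul_nonneg (by linarith) hsnr.le)
  have hs2 : s ^ 2 = B * criticalSnr p k := Real.sq_sqrt (by positivity)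
  have habs : a ^ 2 + b ^ 2 = s ^ 2 := by rw [ha2, hb2, hs2]; ring
  have hab : (a / s) ^ 2 + (b / s) ^ 2 = 1 := by
    rw [div_pow, div_pow, ← add_div, habs, div_self (by positivity)]
  obtain ⟨D, hD, hdec⟩ := exists_measurable_decoder
    (fun S : {S : Finset (Fin p) // S.card = k} => codeword d k S.1)
  have hmain := decoding_le_mean_square_error (a := a) (b := b)
    (X := fun S : {S : Finset (Fin p) // S.card = k} => codeword d k S.1)
    (fun S => norm_codeword d hk S.2) hest hn (D := fun y => D (a • y.1 + b • y.2))
    fun S => (hD S).preimage (f := fun y : Tensor d p × Tensor d p => a • y.1 + b • y.2)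
      (by fun_prop)
  rw [hcard] at hmain
  have hP (S : {S : Finset (Fin p) // S.card = k}) : 1 - decodingErrorBound B ε p k ≤
      ((stdGaussian (Tensor d p)).prod (stdGaussian (Tensor d p))).real
        {w | D (a • (a • codeword d k S.1 + w.1) + b • (b • codeword d k S.1 + w.2)) = S} := by
    have herr := codeword_decoding_error_le hd hk
      (W := fun w : Tensor d p × Tensor d p => (a / s) • w.1 + (b / s) • w.2)
      (hasSubgaussianMGF_inner_prod_stdGaussian hab) S hB.le hε0 hε1 hsmall
    rw [← hs_def] at herr
    set A := {w : Tensor d p × Tensor d p |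
      D (a • (a • codeword d k S.1 + w.1) + b • (b • codeword d k S.1 + w.2)) = S} with hA
    have hcompl : ((stdGaussian (Tensor d p)).prod (stdGaussian (Tensor d p))).real Aᶜ ≤
        decodingErrorBound B ε p k := by
      refine (measureReal_mono fun w hw => ?_).trans herr
      by_contra hc
      simp only [Set.mem_ofPred_eq, not_exists, not_and, not_le] at hc
      refine hw (hdec S _ fun T hT => ?_)
      -- The weights a, b merge the two observations into one at ratio s² = a² + b²; the positive
      -- factor s does not affect the decoder's comparisons.
      have e : a • (a • codeword d k S.1 + w.1) + b • (b • codeword d k S.1 + w.2) =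
          s • (s • codeword d k S.1 + ((a / s) • w.1 + (b / s) • w.2)) := by
        simp only [smul_add, smul_smul, mul_div_cancel₀ _ hs.ne', ← pow_two, ← habs, add_smul]
        abel
      rw [e, inner_smul_right, inner_smul_right]
      exact mul_lt_mul_of_pos_left (hc T hT) hs
    have hunion := measureReal_union_le
      (μ := (stdGaussian (Tensor d p)).prod (stdGaussian (Tensor d p))) A Aᶜ
    rw [Set.union_compl_self, probReal_univ] at hunion
    linarith
  have hsum := Finset.sum_le_sum fun S (_ : S ∈ Finset.univ) => hP S
  rw [Finset.sum_const, Finset.card_univ, hcard, nsmul_eq_mul] at hsum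
  have h := (mul_le_mul_of_nonneg_right hsum hlog.le).trans hmain
  rw [ha2, hb2, criticalSnr] at h
  set total := ∑ S : {S : Finset (Fin p) // S.card = k}, ∫ z,
        ‖codeword d k S.1 - est (a • codeword d k S.1 + z)‖ ^ 2 ∂(stdGaussian (Tensor d p))
  set l := Real.log (p.choose k)
  set M : ℝ := (p.choose k : ℝ)
  have e1 : Real.log 2 / l * l = Real.log 2 := div_mul_cancel₀ _ hlog.ne'
  have e2 : M * (M⁻¹ * total) = total := mul_inv_cancel_left₀ hM.ne' _
  refine le_of_mul_le_mul_right ?_ (mul_pos hM hlog)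
  have r1 : (B - β) * (M⁻¹ * total) * (M * l) = (B - β) * l * total := by
    linear_combination (B - β) * l * e2
  have r2 : (1 - decodingErrorBound B ε p k - β - Real.log 2 / l) * (M * l) =
      M * (1 - decodingErrorBound B ε p k) * l - M * β * l - M * Real.log 2 := by
    linear_combination -M * e1
  rw [r1, r2]
  linarith

end Converse

/-! ### The two limits. -/

theorem theorem3 (d : ℕ) (hd : 2 ≤ d) (k : ℕ → ℕ) (hk_pos : ∀ᶠ p in atTop, 1 ≤ k p)
    (hk : (fun p : ℕ => (k p : ℝ)) =o[atTop]
      fun p : ℕ => (Real.log (p : ℝ)) ^ (1 / (2 * (d : ℝ) - 1))) :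
    (∀ β : ℝ, 0 ≤ β → β < 1 →
      1 ≤ liminf (fun p : ℕ => cmmse d p (k p) (β * criticalSnr p (k p))) atTop) ∧
    (∀ β : ℝ, 1 < β →
      Tendsto (fun p : ℕ => cmmse d p (k p) (β * criticalSnr p (k p))) atTop (𝓝 0)) := by
  have hkle := eventually_le_rpow_and_le_log_choose hk_pos hk (η := 1 / 2) (by norm_num)
    (by norm_num)
  have hlog := tendsto_log_choose hk_pos hk
  constructor
  · intro β hβ0 hβ1
    refine le_of_forall_lt fun c hc => ?_
    obtain ⟨r, hcr, hr1⟩ := exists_between hc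
    refine hcr.trans_le (le_liminf_of_le (by isBoundedDefault) ?_)
    have hr_top : r ≠ ∞ := (hr1.trans ENNReal.one_lt_top).ne
    have hr : r.toReal < 1 := by
      simpa using (ENNReal.toReal_lt_toReal hr_top ENNReal.one_ne_top).2 hr1
    have hr0 : 0 ≤ r.toReal := ENNReal.toReal_nonneg
    -- For this B > 1, r(B - β) = (1 - β)(1 - (1 - r)²) < 1 - β, so the limiting lower bound (1 -
    -- β)/(B - β) exceeds r.
    set B : ℝ := 1 + (1 - β) * (1 - r.toReal) with hBdef
    have hpos : 0 < (1 - β) * (1 - r.toReal) := mul_pos (by linarith) (by linarith)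
    have hB1 : 1 < B := by linarith
    have hgap : r.toReal * (B - β) < 1 - β := by
      have : 0 < (1 - r.toReal) * ((1 - β) * (1 - r.toReal)) := mul_pos (by linarith) hpos
      rw [hBdef]
      nlinarith
    obtain ⟨ε, hε0, hε1, hεB⟩ := exists_margin hB1
    have hsmall := tendsto_mul_exp_neg_log_choose_div hk_pos hk hεB
    have herr := tendsto_decodingErrorBound hk_pos hk (by linarith) hε0 hεB
    have hlim : Tendsto (fun p : ℕ => 1 - decodingErrorBound B ε p (k p) - β -
        Real.log 2 / Real.log (p.choose (k p))) atTop (𝓝 (1 - 0 - β - 0)) :=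
      ((tendsto_const_nhds.sub herr).sub tendsto_const_nhds).sub (hlog.const_div_atTop _)
    filter_upwards [hk_pos, hkle, hlog.eventually_gt_atTop 0,
      hsmall.eventually_le_const (show (0 : ℝ) < 1 / 2 by norm_num),
      hlim.eventually_const_le (show r.toReal * (B - β) < 1 - 0 - β - 0 by linarith)]
      with p hkp hkp' hl hsm hge
    refine le_iInf₂ fun est hest => le_iInf fun hmem => ?_
    have hn (y : Tensor d p) : ‖est y‖ = 1 := mem_sphere_zero_iff_norm.1 (hmem y).2
    rw [meanSquareError_eq_ofReal d hkp hkp'.1 _ hest hn]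
    refine (ENNReal.le_ofReal_iff_toReal_le hr_top (mul_nonneg (by positivity)
      (Finset.sum_nonneg fun S _ => integral_nonneg fun z => by positivity))).2 ?_
    have hconv := meanSquareError_lower_bound_of_decoding hd hkp hkp'.1 hl hβ0 (by linarith) hε0.le hε1 hsm
      hest hn (β := β)
    have h := hge.trans hconv
    rw [mul_comm] at h
    exact le_of_mul_le_mul_left h (by linarith)
  · intro β hβ
    obtain ⟨ε, hε0, hε1, hεB⟩ := exists_margin hβ
    have hsmall := tendsto_mul_exp_neg_log_choose_div hk_pos hk hεB
    have herr := tendsto_decodingErrorBound hk_pos hk (by linarith) hε0 hεB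
    have hlim : Tendsto (fun p => ENNReal.ofReal (4 * decodingErrorBound β ε p (k p))) atTop
        (𝓝 0) := by
      simpa using ENNReal.tendsto_ofReal (herr.const_mul 4)
    refine tendsto_of_tendsto_of_tendsto_of_le_of_le' tendsto_const_nhds hlim
      (Eventually.of_forall fun p => zero_le) ?_
    filter_upwards [hk_pos, hkle, hsmall.eventually_le_const (show (0 : ℝ) < 1 / 2 by norm_num)]
      with p hkp hkp' hsm
    exact cmmse_le_decodingErrorBound hd hkp hkp'.1 (by linarith) hε0.le hε1 hsm
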